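/- Let $c>0$, and let $g$ be the metric of signature $(1,n-1)$ of $n$-dimensional Minkowski space $\mathbb M^n$, $n\ge 1$; write $v\cdot w=g(v,w)$. An *irrotational rigid motion* on an open set $\Omega\subseteq\mathbb M^n$ is a once continuously differentiable vector field $u$ on $\Omega$ with $u\cdot u=c^2$ such that $L_uh=0$ for $h=c^{-2}u^\flat\otimes u^\flat-g$ (rigidity), and whose vorticity $\omega=\tfrac12 P_h(\nabla\wedge u^\flat)$ vanishes on $\Omega$; here $u^\flat=g(u,\cdot)$, and $P_h$ applies $\mathrm{id}-c^{-2}u\otimes u^\flat$ in each argument. A *worldline* is a $C^2$ curve $z:I\to\mathbb M^n$ on a nonempty open interval $I$ with $\dot z\cdot\dot z=c^2$ (so it is timelike and parametrized by eigentime). Put $H_\tau=z(\tau)+\dot z(\tau)^\perp$. A *tube* about $z$ is a connected open set $\Omega$ that contains $z(I)$, is covered by the hyperplanes $H_\tau$ ($\tau\in I$), and in which no two of them intersect: $\Omega\cap H_\tau\cap H_{\tau'}=\emptyset$ for $\tau\ne\tau'$ in $I$. The slices of a set $\Omega$ are called star-shaped about $z$ if for every $\tau\in I$ the set $\Omega\cap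 H_\tau$ is star-shaped with respect to $z(\tau)$. A *unit normal field* on $\Omega$ is a continuous vector field $u$ on $\Omega$ with $u\cdot u=c^2$ that is perpendicular to all slices, i.e. $u(x)\perp\dot z(\tau)^\perp$ for all $\tau\in I$, $x\in\Omega\cap H_\tau$. **Theorem (Noether and Herglotz, part 2).** (1) Let $z:I\to\mathbb M^n$ be a worldline. Then there is a tube about $z$ with slices star-shaped about $z$. On every tube $\Omega$ about $z$ there is a unit normal field $u$ with $u(z(\tau))=\dot z(\tau)$ for all $\tau\in I$, and every unit normal field on $\Omega$ is $u$ or $-u$. Every unit normal field on $\Omega$ is once continuously differentiable and is an irrotational rigid motion on $\Omega$. (2) Conversely, let $u$ be an irrotational rigid motion on an open set $\Omega\subseteq\mathbb M^n$. Then through every point of $\Omega$ there passes a flow line of $u$ (an integral curve in $\Omega$, defined on an open interval). Every flow line $z:I\to\Omega$ of $u$ is a worldline, and there is a tube $U\subseteq\Omega$ about $z$, with slices star-shaped about $z$, on which $u$ is a unit normal field. Moreover, every open set $U\subseteq\Omega$ that contains $z(I)$, is covered by the hyperplanes $H_\tau$ ($\tau\in I$), and has slices star-shaped about $z$, is a tube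 about $z$ on which $u$ is a unit normal field (in particular $U=\Omega$, if $\Omega$ has these properties). -/

import Mathlib

/-- `n = d + 1` dimensional Minkowski space, in affine inertial coordinates
`x 0 = ct, x 1, …, x d`. -/
abbrev Minkowski (d : ℕ) : Type := Fin (d + 1) → ℝ

namespace Minkowski

noncomputable section

/-- The Minkowski metric `g = diag (1, -1, …, -1)`. -/
def g (d : ℕ) : LinearMap.BilinForm ℝ (Minkowski d) :=
  Matrix.toBilin' (Matrix.diagonal (Fin.cons 1 fun _ => -1))

theorem g_apply {d : ℕ} (v w : Minkowski d) :
    g d v w = v 0 * w 0 - ∑ i : Fin d, v i.succ * w i.succ := by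
  simp [g, Matrix.toBilin'_apply, Matrix.diagonal_apply, Fin.sum_univ_succ, sub_eq_add_neg,
    Finset.sum_neg_distrib]

variable {d : ℕ}

/-! ### Motions -/

/-- The motion of an extended body that occupies the open set `Ω` of events: a once continuously
differentiable vector field `u` on `Ω`, timelike and normalized to `g (u, u) = c ^ 2`. -/
structure IsMotion (c : ℝ) (Ω : Set (Minkowski d)) (u : Minkowski d → Minkowski d) : Prop where
  isOpen : IsOpen Ω
  contDiffOn : ContDiffOn ℝ 1 u Ω
  normalized : ∀ x ∈ Ω, g d (u x) (u x) = c ^ 2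

/-- The metric of the local rest spaces, `h = c⁻² u♭ ⊗ u♭ - g`, with `u♭ = g (u, ·)`. -/
def restMetric (c : ℝ) (u : Minkowski d → Minkowski d) (x : Minkowski d) :
    LinearMap.BilinForm ℝ (Minkowski d) :=
  (c ^ 2)⁻¹ • LinearMap.BilinForm.linMulLin (g d (u x)) (g d (u x)) - g d

/-- The Lie derivative `L_u T` of a covariant 2-tensor field `T`, at `x`, on the vectors `X, Y`:
`u (T (X, Y)) - T ([u, X], Y) - T (X, [u, Y])` for the constant fields `X` and `Y`, for which
`[u, X] = - ∂_X u`. -/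
def lieDeriv (u : Minkowski d → Minkowski d)
    (T : Minkowski d → LinearMap.BilinForm ℝ (Minkowski d)) (x X Y : Minkowski d) : ℝ :=
  fderiv ℝ (fun y => T y X Y) x (u x) + T x (fderiv ℝ u x X) Y + T x X (fderiv ℝ u x Y)

/-- Born rigidity on `Ω`: `L_u h = 0`. -/
def IsRigid (c : ℝ) (Ω : Set (Minkowski d)) (u : Minkowski d → Minkowski d) : Prop :=
  ∀ x ∈ Ω, ∀ X Y : Minkowski d, lieDeriv u (restMetric c u) x X Y = 0

/-- The projection `P_h = id - c⁻² u ⊗ u♭` onto the vectors orthogonal to `u`. -/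
def proj (c : ℝ) (u : Minkowski d → Minkowski d) (x X : Minkowski d) : Minkowski d :=
  X - ((c ^ 2)⁻¹ * g d (u x) X) • u x

/-- `(∇ u♭) (X, Y) = (∇_X u♭) (Y)` at `x`. -/
def nablaFlat (u : Minkowski d → Minkowski d) (x X Y : Minkowski d) : ℝ :=
  fderiv ℝ (fun y => g d (u y) Y) x X

/-- The vorticity `ω`, where `2 ω = P_h (∇ ∧ u♭)`. -/
def vorticity (c : ℝ) (u : Minkowski d → Minkowski d) (x X Y : Minkowski d) : ℝ :=
  (1 / 2) * (nablaFlat u x (proj c u x X) (proj c u x Y)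
    - nablaFlat u x (proj c u x Y) (proj c u x X))

/-- Vanishing vorticity on `Ω`. -/
def IsIrrotational (c : ℝ) (Ω : Set (Minkowski d)) (u : Minkowski d → Minkowski d) : Prop :=
  ∀ x ∈ Ω, ∀ X Y : Minkowski d, vorticity c u x X Y = 0

/-- `u` describes an irrotational rigid motion of a body occupying `Ω`. -/
structure IsIrrotationalRigidMotion (c : ℝ) (Ω : Set (Minkowski d))
    (u : Minkowski d → Minkowski d) : Prop where
  isMotion : IsMotion c Ω u
  isRigid : IsRigid c Ω u
  isIrrotational : IsIrrotational c Ω u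

/-- `z`, restricted to the open interval `I` of parameters, is a flow line of `u` in `Ω`. -/
structure IsFlowLine (Ω : Set (Minkowski d)) (u : Minkowski d → Minkowski d)
    (I : Set ℝ) (z : ℝ → Minkowski d) : Prop where
  isOpen : IsOpen I
  nonempty : I.Nonempty
  ordConnected : I.OrdConnected
  mapsTo : Set.MapsTo z I Ω
  isIntegralCurve : IsIntegralCurveOn z (fun _ => u) I

/-! ### The construction from a worldline -/

/-- A twice continuously differentiable timelike curve `z`, parametrized by eigentime in the open
interval `I`. -/
structure IsWorldline (c : ℝ) (I : Set ℝ) (z : ℝ → Minkowski d) : Prop where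
  isOpen : IsOpen I
  nonempty : I.Nonempty
  ordConnected : I.OrdConnected
  contDiffOn : ContDiffOn ℝ 2 z I
  eigentime : ∀ τ ∈ I, g d (deriv z τ) (deriv z τ) = c ^ 2

/-- The hyperplane `H_τ = z τ + (ż τ)^⊥`. -/
def orthHyperplane (z : ℝ → Minkowski d) (τ : ℝ) : Set (Minkowski d) :=
  {x | g d (deriv z τ) (x - z τ) = 0}

/-- `Ω` is a tube about the curve `z`, made up of pieces of the hyperplanes `H_τ`, in which no two
of these hyperplanes intersect. -/
structure IsTube (I : Set ℝ) (z : ℝ → Minkowski d) (Ω : Set (Minkowski d)) : Prop where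
  isOpen : IsOpen Ω
  isConnected : IsConnected Ω
  mapsTo : Set.MapsTo z I Ω
  covered : ∀ x ∈ Ω, ∃ τ ∈ I, x ∈ orthHyperplane z τ
  disjoint : ∀ τ ∈ I, ∀ τ' ∈ I, τ ≠ τ' →
    Ω ∩ orthHyperplane z τ ∩ orthHyperplane z τ' = ∅

/-- Every slice `Ω ∩ H_τ` is star-shaped with respect to the point `z τ`. -/
def HasStarSlices (I : Set ℝ) (z : ℝ → Minkowski d) (Ω : Set (Minkowski d)) : Prop :=
  ∀ τ ∈ I, StarConvex ℝ (z τ) (Ω ∩ orthHyperplane z τ)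

/-- On `Ω`, `u` is a continuous timelike vector field, normalized to `g (u, u) = c ^ 2`, that is
perpendicular to all the slices `Ω ∩ H_τ`. -/
structure IsNormalField (c : ℝ) (I : Set ℝ) (z : ℝ → Minkowski d) (Ω : Set (Minkowski d))
    (u : Minkowski d → Minkowski d) : Prop where
  continuousOn : ContinuousOn u Ω
  normalized : ∀ x ∈ Ω, g d (u x) (u x) = c ^ 2
  perpendicular : ∀ τ ∈ I, ∀ x ∈ Ω ∩ orthHyperplane z τ,
    ∀ w : Minkowski d, g d (deriv z τ) w = 0 → g d (u x) w = 0

end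

end Minkowski

open Set Filter Topology

namespace Minkowski

/-! ### The metric and its calculus -/

variable {d : ℕ}

/-! Both directions rest on a pointwise reformulation. The projected derivative `P_h ∇u♭` has its
symmetric part controlled by `L_u h` and its antisymmetric part by the vorticity, and `∇_X u ⊥ u`
because `u` is normalized. Hence a motion is irrotational and rigid iff `∇_X u = 0` for all `X ⊥ u`
(`IsMotion.isIrrotationalRigidMotion_iff`).

From a worldline to a motion: a point `x` of a tube lies on exactly one `H_τ`, which defines `τ = T
x` as the zero of `height z x`. The crux is `IsTube.heightDeriv_ne_zero`: disjointness of the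
hyperplanes already forces this zero to be simple. So `T` is `C^1` by the implicit function theorem,
its differential is a multiple of `g (ż, ·)`, and `u = ż ∘ T` has a derivative that kills `ż^⊥`.
Another unit normal field is `k u` with `k` continuous and `k ^ 2 = 1`, so connectedness fixes the
sign. For existence of a tube, pieces of hyperplanes are glued inside small convex lenses: within a
lens the height is strictly monotone in the parameter, and causality keeps hyperplanes with distant
parameters away.

From a motion to a worldline: along a segment that starts perpendicularly to `u`, the function `g
(u, w)`, with `w` the direction, solves a homogeneous linear equation and vanishes; hence `u` is
constant there (`IsIrrotationalRigidMotion.eq_of_segment_subset`). So `u = ż τ` on a star-shaped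
slice, and two slices that meet would be parallel, which is impossible for distinct hyperplanes. -/

theorem g_comm (v w : Minkowski d) : g d v w = g d w v := by
  simp [g_apply, mul_comm]

/-- The Minkowski metric as a continuous bilinear map. -/
noncomputable def gL (d : ℕ) : Minkowski d →L[ℝ] Minkowski d →L[ℝ] ℝ :=
  LinearMap.toContinuousBilinearMap (g d)

theorem gL_apply (v w : Minkowski d) : gL d v w = g d v w := rfl

theorem _root_.HasDerivAt.minkowski_g {f h : ℝ → Minkowski d} {f' h' : Minkowski d} {t : ℝ}
    (hf : HasDerivAt f f' t) (hh : HasDerivAt h h' t) :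
    HasDerivAt (fun s => g d (f s) (h s)) (g d (f t) h' + g d f' (h t)) t :=
  (gL d).hasDerivAt_of_bilinear (fun _ => hf) (fun _ => hh)

theorem continuous_g : Continuous fun p : Minkowski d × Minkowski d => g d p.1 p.2 :=
  (gL d).continuous₂

theorem _root_.ContinuousOn.minkowski_g {α : Type*} [TopologicalSpace α] {s : Set α}
    {f h : α → Minkowski d} (hf : ContinuousOn f s) (hh : ContinuousOn h s) :
    ContinuousOn (fun a => g d (f a) (h a)) s :=
  ((gL d).continuous.comp_continuousOn hf).clm_apply hh

theorem _root_.ContinuousAt.minkowski_g {α : Type*} [TopologicalSpace α] {a : α}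
    {f h : α → Minkowski d} (hf : ContinuousAt f a) (hh : ContinuousAt h a) :
    ContinuousAt (fun a => g d (f a) (h a)) a :=
  ((gL d).continuous.continuousAt.comp hf).clm_apply hh

theorem _root_.ContDiffAt.minkowski_g {E : Type*} [NormedAddCommGroup E] [NormedSpace ℝ E]
    {n : WithTop ℕ∞} {a : E} {f h : E → Minkowski d} (hf : ContDiffAt ℝ n f a)
    (hh : ContDiffAt ℝ n h a) : ContDiffAt ℝ n (fun a => g d (f a) (h a)) a :=
  (((gL d).contDiff.contDiffAt (x := f a)).comp a hf).clm_apply hh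

theorem hasFDerivAt_g_const {u : Minkowski d → Minkowski d} {x : Minkowski d}
    (hu : DifferentiableAt ℝ u x) (Y : Minkowski d) :
    HasFDerivAt (fun y => g d (u y) Y) (((gL d).flip Y).comp (fderiv ℝ u x)) x :=
  ((gL d).flip Y).hasFDerivAt.comp x hu.hasFDerivAt

theorem nablaFlat_eq {u : Minkowski d → Minkowski d} {x : Minkowski d}
    (hu : DifferentiableAt ℝ u x) (X Y : Minkowski d) :
    nablaFlat u x X Y = g d (fderiv ℝ u x X) Y := by
  rw [nablaFlat, (hasFDerivAt_g_const hu Y).fderiv]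
  rfl

theorem restMetric_apply (c : ℝ) (u : Minkowski d → Minkowski d) (x X Y : Minkowski d) :
    restMetric c u x X Y = (c ^ 2)⁻¹ * (g d (u x) X * g d (u x) Y) - g d X Y := by
  simp [restMetric]

theorem lieDeriv_restMetric {c : ℝ} {u : Minkowski d → Minkowski d} {x : Minkowski d}
    (hu : DifferentiableAt ℝ u x) (X Y : Minkowski d) :
    lieDeriv u (restMetric c u) x X Y =
      (c ^ 2)⁻¹ * (g d (u x) X * g d (fderiv ℝ u x (u x)) Y
        + g d (fderiv ℝ u x (u x)) X * g d (u x) Y)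
      + restMetric c u x (fderiv ℝ u x X) Y + restMetric c u x X (fderiv ℝ u x Y) := by
  have h := (((hasFDerivAt_g_const hu X).mul (hasFDerivAt_g_const hu Y)).const_mul
    ((c ^ 2)⁻¹)).sub_const (g d X Y)
  have h2 : (fun y => restMetric c u y X Y) =
      fun y => (c ^ 2)⁻¹ * (g d (u y) X * g d (u y) Y) - g d X Y :=
    funext fun y => restMetric_apply c u y X Y
  rw [lieDeriv, h2]
  erw [h.fderiv]
  simp [gL_apply]
  ring

theorem eq_zero_of_forall_g_eq_zero {v : Minkowski d} (h : ∀ w, g d v w = 0) : v = 0 := by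
  funext i
  refine Fin.cases ?_ (fun j => ?_) i
  · have := h (Pi.single 0 1)
    simpa [g_apply, Pi.single_apply] using this
  · have := h (Pi.single j.succ 1)
    simpa [g_apply, Pi.single_apply, (Fin.succ_ne_zero _).symm, Fin.succ_ne_zero] using this

/-! ### Irrotational rigid motions in terms of the derivative of the velocity -/

theorem IsMotion.differentiableAt {c : ℝ} {Ω : Set (Minkowski d)}
    {u : Minkowski d → Minkowski d} (hu : IsMotion c Ω u) {x : Minkowski d} (hx : x ∈ Ω) :
    DifferentiableAt ℝ u x :=
  (hu.contDiffOn.contDiffAt (hu.isOpen.mem_nhds hx)).differentiableAt one_ne_zero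

theorem IsMotion.g_fderiv_self {c : ℝ} {Ω : Set (Minkowski d)}
    {u : Minkowski d → Minkowski d} (hu : IsMotion c Ω u) {x : Minkowski d} (hx : x ∈ Ω)
    (X : Minkowski d) : g d (fderiv ℝ u x X) (u x) = 0 := by
  have hd := (hu.differentiableAt hx).hasFDerivAt
  have h1 := (gL d).hasFDerivAt_of_bilinear hd hd
  have h2 : (fun y => gL d (u y) (u y)) =ᶠ[𝓝 x] fun _ => c ^ 2 :=
    eventually_of_mem (hu.isOpen.mem_nhds hx) hu.normalized
  have h3 := h1.unique ((hasFDerivAt_const (c ^ 2) x).congr_of_eventuallyEq h2)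
  have h4 := congrArg (fun A => A X) h3
  simp [gL_apply, g_comm (u x)] at h4
  linarith

/-- A motion is irrotational and rigid iff its derivative annihilates the local rest spaces. -/
theorem IsMotion.isIrrotationalRigidMotion_iff {c : ℝ} (hc : c ≠ 0) {Ω : Set (Minkowski d)}
    {u : Minkowski d → Minkowski d} (hu : IsMotion c Ω u) :
    IsIrrotationalRigidMotion c Ω u ↔ ∀ x ∈ Ω, ∀ X,
      fderiv ℝ u x X = ((c ^ 2)⁻¹ * g d (u x) X) • fderiv ℝ u x (u x) := by
  have hc2 : c ^ 2 ≠ 0 := pow_ne_zero 2 hc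
  have hinv : (c ^ 2)⁻¹ * c ^ 2 = 1 := inv_mul_cancel₀ hc2
  constructor
  · intro h x hx X
    have hd := hu.differentiableAt hx
    have hn := hu.normalized x hx
    have hself := hu.g_fderiv_self hx
    have hpu : ∀ X, g d (u x) (proj c u x X) = 0 := fun X => by
      simp only [proj, map_sub, map_smul, smul_eq_mul, hn]
      linear_combination (-g d (u x) X) * hinv
    -- On projected vectors the terms of `L_u h` containing `u♭` drop out, leaving minus the
    -- symmetrized derivative; the vorticity is half the antisymmetrized one. Both vanish.
    have key : ∀ X Y, g d (fderiv ℝ u x (proj c u x X)) (proj c u x Y) = 0 := by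
      intro X Y
      have h1 := h.isIrrotational x hx X Y
      have h2 := h.isRigid x hx (proj c u x X) (proj c u x Y)
      rw [vorticity, nablaFlat_eq hd, nablaFlat_eq hd] at h1
      rw [lieDeriv_restMetric hd, restMetric_apply, restMetric_apply, hpu, hpu,
        g_comm (proj c u x X)] at h2
      linarith
    have h0 : fderiv ℝ u x (proj c u x X) = 0 := by
      refine eq_zero_of_forall_g_eq_zero fun w => ?_
      -- The second projection can be dropped, since every derivative of `u` is orthogonal to `u`.
      have h1 := key X w
      rwa [proj.eq_def c u x w, map_sub, map_smul, hself, smul_zero, sub_zero] at h1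
    rw [proj, map_sub, map_smul] at h0
    exact sub_eq_zero.mp h0
  · intro h
    refine ⟨hu, fun x hx X Y => ?_, fun x hx X Y => ?_⟩
    · have hself := hu.g_fderiv_self hx (u x)
      rw [lieDeriv_restMetric (hu.differentiableAt hx), restMetric_apply, restMetric_apply,
        h x hx X, h x hx Y]
      simp only [map_smul, LinearMap.smul_apply, smul_eq_mul, g_comm (u x) (fderiv ℝ u x (u x)),
        hself, g_comm X (fderiv ℝ u x (u x))]
      ring
    · have hn := hu.normalized x hx
      have hpu : ∀ X, g d (u x) (proj c u x X) = 0 := fun X => by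
        simp only [proj, map_sub, map_smul, smul_eq_mul, hn]
        linear_combination (-g d (u x) X) * hinv
      have hd := hu.differentiableAt hx
      rw [vorticity, nablaFlat_eq hd, nablaFlat_eq hd, h x hx (proj c u x X),
        h x hx (proj c u x Y), hpu, hpu]
      simp

/-! ### Timelike vectors -/

/-- Cauchy–Schwarz for the space components. The factor `ε` treats both time orientations at once.
-/
theorem g_pos {v w : Minkowski d} {ε : ℝ} (hv : 0 < g d v v) (hw : 0 < g d w w)
    (hv0 : 0 < ε * v 0) (hw0 : 0 < ε * w 0) : 0 < g d v w := by
  rw [g_apply] at *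
  have hcs := Finset.sum_mul_sq_le_sq_mul_sq Finset.univ (fun i : Fin d => v i.succ)
    (fun i => w i.succ)
  simp only [← pow_two] at hv hw
  have hA : 0 ≤ ∑ i : Fin d, v i.succ ^ 2 := Finset.sum_nonneg fun i _ => sq_nonneg _
  have hB : 0 ≤ ∑ i : Fin d, w i.succ ^ 2 := Finset.sum_nonneg fun i _ => sq_nonneg _
  have hpos : 0 < v 0 * w 0 := by
    have h1 : 0 < (ε * v 0) * (ε * w 0) := mul_pos hv0 hw0
    have h2 : (ε * v 0) * (ε * w 0) = ε ^ 2 * (v 0 * w 0) := by ring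
    rw [h2] at h1
    exact pos_of_mul_pos_right h1 (sq_nonneg ε)
  have h3 : (∑ i : Fin d, v i.succ * w i.succ) ^ 2 < (v 0 * w 0) ^ 2 := by
    refine hcs.trans_lt ?_
    rw [mul_pow]
    exact mul_lt_mul'' (by linarith) (by linarith) hA hB
  linarith [lt_of_pow_lt_pow_left₀ 2 hpos.le h3]

/-- Cauchy–Schwarz again: the orthogonal complement of a timelike vector is spacelike. -/
theorem g_self_neg {v w : Minkowski d} (hv : 0 < g d v v) (hvw : g d v w = 0) (hw : w ≠ 0) :
    g d w w < 0 := by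
  rw [g_apply] at *
  simp only [← pow_two] at *
  have hcs := Finset.sum_mul_sq_le_sq_mul_sq Finset.univ (fun i : Fin d => v i.succ)
    (fun i => w i.succ)
  have hA : 0 ≤ ∑ i : Fin d, v i.succ ^ 2 := Finset.sum_nonneg fun i _ => sq_nonneg _
  have hB : 0 ≤ ∑ i : Fin d, w i.succ ^ 2 := Finset.sum_nonneg fun i _ => sq_nonneg _
  rw [← sub_eq_zero.mp hvw, mul_pow] at hcs
  rcases hB.eq_or_lt with hB | hB
  · exfalso
    have h0 : ∀ i : Fin d, w i.succ = 0 := fun i => by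
      have := (Finset.sum_eq_zero_iff_of_nonneg fun i _ => sq_nonneg _).mp hB.symm i
        (Finset.mem_univ i)
      exact pow_eq_zero_iff two_ne_zero |>.mp this
    refine hw (funext fun i => Fin.cases ?_ h0 i)
    simp only [h0, mul_zero, Finset.sum_const_zero, sub_zero] at hvw
    rcases mul_eq_zero.mp hvw with h | h
    · rw [h] at hv
      linarith
    · exact h
  · by_contra hcon
    have h1 : ∑ i : Fin d, w i.succ ^ 2 ≤ w 0 ^ 2 := by linarith
    have h2 : (∑ i : Fin d, v i.succ ^ 2) * ∑ i : Fin d, w i.succ ^ 2 <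
        v 0 ^ 2 * ∑ i : Fin d, w i.succ ^ 2 := mul_lt_mul_of_pos_right (by linarith) hB
    have h3 := mul_le_mul_of_nonneg_left h1 (sq_nonneg (v 0))
    linarith

/-- The cone of the timelike vectors `w` whose time component has the sign of `ε`. -/
def timeCone (d : ℕ) (ε : ℝ) : Set (Minkowski d) := {w | 0 < ε * w 0 ∧ 0 < g d w w}

theorem isOpen_timeCone (ε : ℝ) : IsOpen (timeCone d ε) := by
  have h : Continuous fun w : Minkowski d => g d w w :=
    continuous_g.comp (continuous_id.prodMk continuous_id)
  exact ((isOpen_lt continuous_const (continuous_const.mul (continuous_apply 0))).inter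
    (isOpen_lt continuous_const h))

theorem g_pos_of_mem_timeCone {ε : ℝ} {v w : Minkowski d} (hv : v ∈ timeCone d ε)
    (hw : w ∈ timeCone d ε) : 0 < g d v w :=
  g_pos hv.2 hw.2 hv.1 hw.1

theorem smul_mem_timeCone {ε t : ℝ} {v : Minkowski d} (hv : v ∈ timeCone d ε) (ht : 0 < t) :
    t • v ∈ timeCone d ε := by
  refine ⟨?_, ?_⟩
  · have := mul_pos ht hv.1
    simp only [Pi.smul_apply, smul_eq_mul]
    linarith
  · have := mul_pos ht (mul_pos ht hv.2)
    simpa using this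

end Minkowski

/-! ### Worldlines and the height function -/

namespace Minkowski

variable {d : ℕ}

/-- The function of the parameter `s` that vanishes where `x` lies on the hyperplane `H_s`. -/
noncomputable def height (z : ℝ → Minkowski d) (x : Minkowski d) (s : ℝ) : ℝ :=
  g d (deriv z s) (x - z s)

/-- The derivative of `height z x`, for curves parametrized by eigentime. -/
noncomputable def heightDeriv (c : ℝ) (z : ℝ → Minkowski d) (x : Minkowski d) (s : ℝ) : ℝ :=
  g d (deriv (deriv z) s) (x - z s) - c ^ 2

theorem mem_orthHyperplane_iff {z : ℝ → Minkowski d} {x : Minkowski d} {s : ℝ} :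
    x ∈ orthHyperplane z s ↔ height z x s = 0 := Iff.rfl

namespace IsWorldline

variable {c : ℝ} {I : Set ℝ} {z : ℝ → Minkowski d}

theorem hasDerivAt (hz : IsWorldline c I z) {τ : ℝ} (hτ : τ ∈ I) :
    HasDerivAt z (deriv z τ) τ :=
  ((hz.contDiffOn.contDiffAt (hz.isOpen.mem_nhds hτ)).differentiableAt two_ne_zero).hasDerivAt

theorem continuousOn (hz : IsWorldline c I z) : ContinuousOn z I := hz.contDiffOn.continuousOn

theorem contDiffOn_deriv (hz : IsWorldline c I z) : ContDiffOn ℝ 1 (deriv z) I :=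
  ((contDiffOn_succ_iff_deriv_of_isOpen (n := 1) hz.isOpen).mp
    (by simpa [one_add_one_eq_two] using hz.contDiffOn)).2.2

theorem contDiffAt_deriv (hz : IsWorldline c I z) {τ : ℝ} (hτ : τ ∈ I) :
    ContDiffAt ℝ 1 (deriv z) τ :=
  hz.contDiffOn_deriv.contDiffAt (hz.isOpen.mem_nhds hτ)

theorem hasDerivAt_deriv (hz : IsWorldline c I z) {τ : ℝ} (hτ : τ ∈ I) :
    HasDerivAt (deriv z) (deriv (deriv z) τ) τ :=
  ((hz.contDiffAt_deriv hτ).differentiableAt one_ne_zero).hasDerivAt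

theorem continuousOn_deriv_deriv (hz : IsWorldline c I z) :
    ContinuousOn (deriv (deriv z)) I :=
  ((contDiffOn_succ_iff_deriv_of_isOpen (n := 0) hz.isOpen).mp
    (by simpa using hz.contDiffOn_deriv)).2.2.continuousOn

theorem g_deriv_deriv_deriv (hz : IsWorldline c I z) {τ : ℝ} (hτ : τ ∈ I) :
    g d (deriv z τ) (deriv (deriv z) τ) = 0 := by
  have h := (hz.hasDerivAt_deriv hτ).minkowski_g (hz.hasDerivAt_deriv hτ)
  have h2 : (fun s => g d (deriv z s) (deriv z s)) =ᶠ[𝓝 τ] fun _ => c ^ 2 :=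
    eventually_of_mem (hz.isOpen.mem_nhds hτ) hz.eigentime
  have h3 := h.unique ((hasDerivAt_const τ (c ^ 2)).congr_of_eventuallyEq h2)
  rw [g_comm (deriv (deriv z) τ)] at h3
  linarith

theorem hasDerivAt_height (hz : IsWorldline c I z) (x : Minkowski d) {τ : ℝ} (hτ : τ ∈ I) :
    HasDerivAt (height z x) (heightDeriv c z x τ) τ := by
  have h := (hz.hasDerivAt_deriv hτ).minkowski_g ((hz.hasDerivAt hτ).const_sub x)
  refine h.congr_deriv ?_
  rw [map_neg, hz.eigentime τ hτ, heightDeriv]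
  ring

theorem continuousOn_height (hz : IsWorldline c I z) (x : Minkowski d) :
    ContinuousOn (height z x) I :=
  fun _ hτ => (hz.hasDerivAt_height x hτ).continuousAt.continuousWithinAt

theorem continuous_height (z : ℝ → Minkowski d) (s : ℝ) :
    Continuous fun x => height z x s :=
  ((gL d) (deriv z s)).continuous.comp (continuous_id.sub continuous_const)

theorem contDiffAt_height (hz : IsWorldline c I z) (x : Minkowski d) {τ : ℝ} (hτ : τ ∈ I) :
    ContDiffAt ℝ 1 (fun p : Minkowski d × ℝ => height z p.1 p.2) (x, τ) := by
  have h1 : ContDiffAt ℝ 1 (fun p : Minkowski d × ℝ => deriv z p.2) (x, τ) :=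
    ContDiffAt.comp (g := deriv z) (x, τ) (hz.contDiffAt_deriv hτ) contDiffAt_snd
  have h2 : ContDiffAt ℝ 1 (fun p : Minkowski d × ℝ => z p.2) (x, τ) :=
    ContDiffAt.comp (g := z) (x, τ)
      ((hz.contDiffOn.contDiffAt (hz.isOpen.mem_nhds hτ)).of_le one_le_two) contDiffAt_snd
  exact h1.minkowski_g (contDiffAt_fst.sub h2)

theorem continuousAt_heightDeriv (hz : IsWorldline c I z) (x : Minkowski d) {τ : ℝ}
    (hτ : τ ∈ I) :
    ContinuousAt (fun p : Minkowski d × ℝ => heightDeriv c z p.1 p.2) (x, τ) := by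
  have hI := hz.isOpen.mem_nhds hτ
  have h1 : ContinuousAt (fun p : Minkowski d × ℝ => deriv (deriv z) p.2) (x, τ) :=
    ContinuousAt.comp (g := deriv (deriv z)) (hz.continuousOn_deriv_deriv.continuousAt hI)
      continuousAt_snd
  have h2 : ContinuousAt (fun p : Minkowski d × ℝ => z p.2) (x, τ) :=
    ContinuousAt.comp (g := z) (hz.continuousOn.continuousAt hI) continuousAt_snd
  exact (h1.minkowski_g (continuousAt_fst.sub h2)).sub continuousAt_const

/-- A worldline is future directed, or it is past directed. -/
theorem exists_timeCone (hz : IsWorldline c I z) (hc : 0 < c) :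
    ∃ ε : ℝ, ∀ τ ∈ I, deriv z τ ∈ timeCone d ε := by
  obtain ⟨τ₀, hτ₀⟩ := hz.nonempty
  have hne : ∀ τ ∈ I, deriv z τ 0 ≠ 0 := fun τ hτ h0 => by
    have h := hz.eigentime τ hτ
    rw [g_apply, h0] at h
    have hs : 0 ≤ ∑ i : Fin d, deriv z τ i.succ * deriv z τ i.succ :=
      Finset.sum_nonneg fun i _ => mul_self_nonneg _
    have := pow_pos hc 2
    linarith
  -- The time component of `ż` never vanishes, so by the intermediate value theorem it keeps its
  -- sign at `τ₀`.
  refine ⟨deriv z τ₀ 0, fun τ hτ => ⟨?_, by rw [hz.eigentime τ hτ]; positivity⟩⟩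
  by_contra hcon
  have hcont : ContinuousOn (fun s => deriv z τ₀ 0 * deriv z s 0) I :=
    continuousOn_const.mul
      ((continuous_apply 0).comp_continuousOn hz.contDiffOn_deriv.continuousOn)
  obtain ⟨s, hs, hs0⟩ := hz.ordConnected.isPreconnected.intermediate_value hτ hτ₀ hcont
    ⟨not_lt.mp hcon, mul_self_nonneg _⟩
  exact (mul_ne_zero (hne τ₀ hτ₀) (hne s hs)) hs0

/-- `s ↦ g (v, z s)` is strictly increasing, its derivative `g (v, ż)` being positive within one
cone. -/
theorem g_sub_pos (hz : IsWorldline c I z) {ε : ℝ} (hε : ∀ τ ∈ I, deriv z τ ∈ timeCone d ε)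
    {v : Minkowski d} (hv : v ∈ timeCone d ε) {a b : ℝ} (ha : a ∈ I) (hb : b ∈ I)
    (hab : a < b) : 0 < g d v (z b - z a) := by
  have hd : ∀ s ∈ I, HasDerivAt (fun s => g d v (z s)) (g d v (deriv z s)) s := fun s hs => by
    simpa using (hasDerivAt_const s v).minkowski_g (hz.hasDerivAt hs)
  have hmono : StrictMonoOn (fun s => g d v (z s)) I := by
    refine strictMonoOn_of_deriv_pos hz.ordConnected.convex
      (fun s hs => (hd s hs).continuousAt.continuousWithinAt) fun s hs => ?_
    have hs := interior_subset hs
    rw [(hd s hs).deriv]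
    exact g_pos_of_mem_timeCone hv (hε s hs)
  rw [map_sub]
  exact sub_pos.mpr (hmono ha hb hab)

/-- The difference quotients converge to `ż τ`, which lies in the open cone; the cone is invariant
under positive scaling. -/
theorem eventually_sub_mem_timeCone (hz : IsWorldline c I z) {ε : ℝ}
    (hε : ∀ τ ∈ I, deriv z τ ∈ timeCone d ε) {τ : ℝ} (hτ : τ ∈ I) :
    ∀ᶠ δ in 𝓝[>] (0 : ℝ), z (τ + δ) - z τ ∈ timeCone d ε ∧ z τ - z (τ - δ) ∈ timeCone d ε := by
  have hO := (isOpen_timeCone (d := d) ε).mem_nhds (hε τ hτ)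
  have hd := (hz.hasDerivAt hτ).tendsto_slope_zero
  have h1 : Tendsto (fun δ : ℝ => δ) (𝓝[>] 0) (𝓝[≠] 0) :=
    tendsto_id.mono_right (nhdsWithin_mono _ fun x hx => ne_of_gt hx)
  have h2 : Tendsto (fun δ : ℝ => -δ) (𝓝[>] 0) (𝓝[≠] 0) := by
    refine tendsto_nhdsWithin_iff.mpr ⟨?_, ?_⟩
    · exact (tendsto_nhdsWithin_of_tendsto_nhds (by simpa using (continuous_neg (G := ℝ)).tendsto 0))
    · filter_upwards [self_mem_nhdsWithin] with δ hδ
      exact neg_ne_zero.mpr (ne_of_gt hδ)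
  filter_upwards [(hd.comp h1) hO, (hd.comp h2) hO, self_mem_nhdsWithin] with δ ha hb hδ
  have hδ : 0 < δ := hδ
  constructor
  · have := smul_mem_timeCone ha hδ
    simpa [smul_smul, hδ.ne'] using this
  · have := smul_mem_timeCone hb hδ
    simpa [smul_smul, hδ.ne', ← sub_eq_add_neg, smul_sub, inv_neg, neg_smul, neg_add_eq_sub]
      using this

end IsWorldline

/-! ### Tubes about a worldline -/

/-- Each point is joined to the connected curve by a segment in its slice. -/
theorem HasStarSlices.isConnected {I : Set ℝ} {z : ℝ → Minkowski d} {U : Set (Minkowski d)}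
    (hU : HasStarSlices I z U) (hz : ContinuousOn z I) (hI : I.OrdConnected)
    (hne : I.Nonempty) (hmaps : MapsTo z I U)
    (hcov : ∀ x ∈ U, ∃ τ ∈ I, x ∈ orthHyperplane z τ) : IsConnected U := by
  obtain ⟨τ₀, hτ₀⟩ := hne
  refine ⟨⟨z τ₀, hmaps hτ₀⟩, isPreconnected_of_forall (z τ₀) fun x hx => ?_⟩
  obtain ⟨τ, hτ, hxτ⟩ := hcov x hx
  refine ⟨z '' I ∪ segment ℝ (z τ) x, union_subset hmaps.image_subset ?_,
    Or.inl (mem_image_of_mem z hτ₀), Or.inr (right_mem_segment ℝ _ _), ?_⟩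
  · exact ((hU τ hτ).segment_subset ⟨hx, hxτ⟩).trans inter_subset_left
  · exact (hI.isPreconnected.image z hz).union (z τ) (mem_image_of_mem z hτ)
      (left_mem_segment ℝ _ _) (convex_segment _ _).isPreconnected

/-- An open convex set `V` between the events `z a` and `z b` of a worldline, in which the
hyperplanes `H_s` with `a ≤ s ≤ b` advance with `s`. -/
structure IsLens (c : ℝ) (I : Set ℝ) (z : ℝ → Minkowski d) (ε : ℝ) (Ω V : Set (Minkowski d))
    (a b : ℝ) : Prop where
  isOpen : IsOpen V
  convex : Convex ℝ V
  subset : V ⊆ Ω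
  Icc_subset : Icc a b ⊆ I
  before : ∀ y ∈ V, z b - y ∈ timeCone d ε
  after : ∀ y ∈ V, y - z a ∈ timeCone d ε
  heightDeriv_neg : ∀ y ∈ V, ∀ s ∈ Icc a b, heightDeriv c z y s < 0

variable {c : ℝ} {I : Set ℝ} {z : ℝ → Minkowski d} {ε : ℝ} {Ω V : Set (Minkowski d)} {a b : ℝ}

theorem IsLens.strictAntiOn (hV : IsLens c I z ε Ω V a b) (hz : IsWorldline c I z)
    {x : Minkowski d} (hx : x ∈ V) : StrictAntiOn (height z x) (Icc a b) := by
  refine strictAntiOn_of_deriv_neg (convex_Icc a b)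
    ((hz.continuousOn_height x).mono hV.Icc_subset) fun s hs => ?_
  have hs := interior_subset hs
  rw [(hz.hasDerivAt_height x (hV.Icc_subset hs)).deriv]
  exact hV.heightDeriv_neg x hx s hs

/-- Parameters in `[a, b]` are separated by monotonicity of the height. Outside, causality decides:
if `τ' < a`, then `x - z τ'` is the sum of `x - z a` and `z a - z τ'`, both of positive product with
`ż τ'`, so `x` is not on `H_τ'`; similarly beyond `b`. -/
theorem IsLens.eq_of_height_eq_zero (hV : IsLens c I z ε Ω V a b) (hz : IsWorldline c I z)
    (hε : ∀ τ ∈ I, deriv z τ ∈ timeCone d ε) {x : Minkowski d} (hx : x ∈ V) {τ τ' : ℝ}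
    (hτ : τ ∈ Ioo a b) (h : height z x τ = 0) (hτ' : τ' ∈ I) (h' : height z x τ' = 0) :
    τ' = τ := by
  have hab : a ≤ b := (hτ.1.trans hτ.2).le
  have ha := hV.Icc_subset (left_mem_Icc.mpr hab)
  have hb := hV.Icc_subset (right_mem_Icc.mpr hab)
  have hcone := hε τ' hτ'
  rw [height] at h'
  rcases lt_or_ge τ' a with hlt | hge
  · have h1 := g_pos_of_mem_timeCone hcone (hV.after x hx)
    have h2 := hz.g_sub_pos hε hcone hτ' ha hlt
    rw [map_sub] at h1 h2 h'
    linarith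
  rcases lt_or_ge b τ' with hlt | hle
  · have h1 := g_pos_of_mem_timeCone hcone (hV.before x hx)
    have h2 := hz.g_sub_pos hε hcone hb hτ' hlt
    rw [map_sub] at h1 h2 h'
    linarith
  exact (hV.strictAntiOn hz hx).injOn ⟨hge, hle⟩ (Ioo_subset_Icc_self hτ) (h'.trans h.symm)

/-- At `x = z τ` the height has derivative `-c ^ 2 < 0`. This and the two cone conditions are open,
so they persist on a small ball and parameter interval. -/
theorem IsWorldline.exists_isLens (hz : IsWorldline c I z) (hc : 0 < c)
    (hε : ∀ τ ∈ I, deriv z τ ∈ timeCone d ε) (hΩ : IsOpen Ω) (hmaps : MapsTo z I Ω) {τ : ℝ}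
    (hτ : τ ∈ I) : ∃ V a b, IsLens c I z ε Ω V a b ∧ τ ∈ Ioo a b ∧ z τ ∈ V := by
  have h0 : heightDeriv c z (z τ) τ < 0 := by
    rw [heightDeriv, sub_self, map_zero]
    linarith [pow_pos hc 2]
  have h1 : ∀ᶠ p : Minkowski d × ℝ in 𝓝 (z τ) ×ˢ 𝓝 τ, heightDeriv c z p.1 p.2 < 0 := by
    rw [← nhds_prod_eq]
    exact (hz.continuousAt_heightDeriv (z τ) hτ).eventually_lt continuousAt_const h0
  obtain ⟨P, hP, Q, hQ, hPQ⟩ := eventually_prod_iff.mp h1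
  obtain ⟨η, hη, hηI⟩ := Metric.nhds_basis_closedBall.eventually_iff.mp
    (hQ.and (hz.isOpen.eventually_mem hτ))
  obtain ⟨δ, ⟨hδ1, hδ2⟩, hδ0, hδη⟩ := ((hz.eventually_sub_mem_timeCone hε hτ).and
    (Ioo_mem_nhdsGT hη)).exists
  have hIcc : ∀ s ∈ Icc (τ - δ) (τ + δ), Q s ∧ s ∈ I := fun s hs => hηI (by
    rw [Metric.mem_closedBall, Real.dist_eq, abs_le]
    constructor <;> linarith [hs.1, hs.2])
  have h2 : ∀ᶠ y in 𝓝 (z τ), z (τ + δ) - y ∈ timeCone d ε :=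
    (continuousAt_const.sub continuousAt_id).eventually_mem ((isOpen_timeCone ε).mem_nhds hδ1)
  have h3 : ∀ᶠ y in 𝓝 (z τ), y - z (τ - δ) ∈ timeCone d ε :=
    (continuousAt_id.sub continuousAt_const).eventually_mem ((isOpen_timeCone ε).mem_nhds hδ2)
  obtain ⟨ρ, hρ, hball⟩ := Metric.nhds_basis_ball.eventually_iff.mp
    (hP.and (h2.and (h3.and (hΩ.eventually_mem (hmaps hτ)))))
  refine ⟨Metric.ball (z τ) ρ, τ - δ, τ + δ, ⟨Metric.isOpen_ball, convex_ball _ _,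
    fun y hy => (hball hy).2.2.2, fun s hs => (hIcc s hs).2, fun y hy => (hball hy).2.1,
    fun y hy => (hball hy).2.2.1, fun y hy s hs => hPQ (hball hy).1 (hIcc s hs).1⟩,
    ⟨by linarith, by linarith⟩, Metric.mem_ball_self hρ⟩

/-- The union of the pieces of the hyperplanes `H_τ` inside the lenses about `z τ`. -/
def lensTube (c : ℝ) (I : Set ℝ) (z : ℝ → Minkowski d) (ε : ℝ) (Ω : Set (Minkowski d)) :
    Set (Minkowski d) :=
  {x | ∃ V a b τ, IsLens c I z ε Ω V a b ∧ τ ∈ Ioo a b ∧ z τ ∈ V ∧ x ∈ V ∧ height z x τ = 0}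

/-- The height at `x` changes sign strictly across `τ`. Nearby points inherit the signs at `τ - η`
and `τ + η`, hence a zero in between, with the same lens as witness. -/
theorem isOpen_lensTube (hz : IsWorldline c I z) : IsOpen (lensTube c I z ε Ω) := by
  rw [isOpen_iff_mem_nhds]
  rintro x ⟨V, a, b, τ, hV, hτ, hzV, hxV, hx⟩
  have hτI := hV.Icc_subset (Ioo_subset_Icc_self hτ)
  have hev : ∀ᶠ s in 𝓝 τ, s ∈ Ioo a b ∧ z s ∈ V :=
    (isOpen_Ioo.eventually_mem hτ).and
      ((hz.hasDerivAt hτI).continuousAt.eventually_mem (hV.isOpen.mem_nhds hzV))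
  obtain ⟨η, hη, hball⟩ := Metric.nhds_basis_closedBall.eventually_iff.mp hev
  have hIcc : ∀ s ∈ Icc (τ - η) (τ + η), s ∈ Ioo a b ∧ z s ∈ V := fun s hs => hball (by
    rw [Metric.mem_closedBall, Real.dist_eq, abs_le]
    constructor <;> linarith [hs.1, hs.2])
  have hl := Ioo_subset_Icc_self (hIcc (τ - η) ⟨le_rfl, by linarith⟩).1
  have hr := Ioo_subset_Icc_self (hIcc (τ + η) ⟨by linarith, le_rfl⟩).1
  have hanti := hV.strictAntiOn hz hxV
  have h1 : 0 < height z x (τ - η) := by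
    rw [← hx]
    exact hanti hl (Ioo_subset_Icc_self hτ) (by linarith)
  have h2 : height z x (τ + η) < 0 := by
    rw [← hx]
    exact hanti (Ioo_subset_Icc_self hτ) hr (by linarith)
  filter_upwards [hV.isOpen.mem_nhds hxV,
    (IsWorldline.continuous_height z (τ - η)).continuousAt.eventually_mem (Ioi_mem_nhds h1),
    (IsWorldline.continuous_height z (τ + η)).continuousAt.eventually_mem (Iio_mem_nhds h2)]
    with y hyV hy1 hy2
  obtain ⟨s, hs, hys⟩ := intermediate_value_Icc' (by linarith : τ - η ≤ τ + η)
    ((hz.continuousOn_height y).mono fun s hs =>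
      hV.Icc_subset (Ioo_subset_Icc_self (hIcc s hs).1)) ⟨hy2.le, hy1.le⟩
  exact ⟨V, a, b, s, hV, (hIcc s hs).1, (hIcc s hs).2, hyV, hys⟩

theorem convex_orthHyperplane (z : ℝ → Minkowski d) (τ : ℝ) :
    Convex ℝ (orthHyperplane z τ) := by
  intro x hx y hy a b _ _ hab
  have h : a • x + b • y - z τ = a • (x - z τ) + b • (y - z τ) := by
    rw [smul_sub, smul_sub, sub_add_sub_comm, ← add_smul, hab, one_smul]
  have hx : g d (deriv z τ) (x - z τ) = 0 := hx
  have hy : g d (deriv z τ) (y - z τ) = 0 := hy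
  change g d (deriv z τ) (a • x + b • y - z τ) = 0
  rw [h, map_add, map_smul, map_smul, hx, hy, smul_zero, smul_zero, add_zero]

theorem mem_orthHyperplane_self (z : ℝ → Minkowski d) (τ : ℝ) : z τ ∈ orthHyperplane z τ := by
  rw [mem_orthHyperplane_iff, height, sub_self, map_zero]

theorem hasStarSlices_lensTube (hz : IsWorldline c I z)
    (hε : ∀ τ ∈ I, deriv z τ ∈ timeCone d ε) :
    HasStarSlices I z (lensTube c I z ε Ω) := by
  intro τ hτ
  refine starConvex_iff_segment_subset.mpr ?_
  rintro x ⟨⟨V, a, b, σ, hV, hσ, hzV, hxV, hx⟩, hxτ⟩ y hy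
  -- The hyperplane that witnesses `x` in the lens is `H_τ` itself, so `z τ` lies in the same convex
  -- lens as `x`.
  obtain rfl := hV.eq_of_height_eq_zero hz hε hxV hσ hx hτ hxτ
  have hyH := (convex_orthHyperplane z τ).segment_subset (mem_orthHyperplane_self z τ) hxτ hy
  exact ⟨⟨V, a, b, τ, hV, hσ, hzV, hV.convex.segment_subset hzV hxV hy, hyH⟩, hyH⟩

/-- Every open set about a worldline contains a tube about it, with star-shaped slices. -/
theorem IsWorldline.exists_isTube (hz : IsWorldline c I z) (hc : 0 < c) (hΩ : IsOpen Ω)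
    (hmaps : MapsTo z I Ω) : ∃ U ⊆ Ω, IsTube I z U ∧ HasStarSlices I z U := by
  obtain ⟨ε, hε⟩ := hz.exists_timeCone hc
  have hmapsU : MapsTo z I (lensTube c I z ε Ω) := fun τ hτ => by
    obtain ⟨V, a, b, hV, hτ', hzV⟩ := hz.exists_isLens hc hε hΩ hmaps hτ
    exact ⟨V, a, b, τ, hV, hτ', hzV, hzV, mem_orthHyperplane_self z τ⟩
  have hcov : ∀ x ∈ lensTube c I z ε Ω, ∃ τ ∈ I, x ∈ orthHyperplane z τ := by
    rintro x ⟨V, a, b, τ, hV, hτ, -, -, hx⟩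
    exact ⟨τ, hV.Icc_subset (Ioo_subset_Icc_self hτ), hx⟩
  have hstar := hasStarSlices_lensTube (Ω := Ω) hz hε
  refine ⟨lensTube c I z ε Ω, ?_, ⟨isOpen_lensTube hz, ?_, hmapsU, hcov, ?_⟩, hstar⟩
  · rintro x ⟨V, a, b, τ, hV, -, -, hxV, -⟩
    exact hV.subset hxV
  · exact hstar.isConnected hz.continuousOn hz.ordConnected hz.nonempty hmapsU hcov
  · intro τ hτ τ' hτ' hne
    refine eq_empty_of_forall_notMem ?_
    rintro x ⟨⟨⟨V, a, b, σ, hV, hσ, -, hxV, hx⟩, hxτ⟩, hxτ'⟩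
    exact hne ((hV.eq_of_height_eq_zero hz hε hxV hσ hx hτ hxτ).trans
      (hV.eq_of_height_eq_zero hz hε hxV hσ hx hτ' hxτ').symm)


end Minkowski

namespace Minkowski

variable {d : ℕ} {c : ℝ} {I : Set ℝ} {z : ℝ → Minkowski d} {Ω U : Set (Minkowski d)}
  {u v : Minkowski d → Minkowski d}

/-! ### Normal fields on a tube -/

/-- The function is negative just after `a` and cannot change sign without a further zero. -/
theorem neg_of_hasDerivAt_neg {f : ℝ → ℝ} {f' a b : ℝ} (hab : a < b)
    (hcont : ContinuousOn f (Icc a b)) (ha : f a = 0) (hd : HasDerivAt f f' a) (hf' : f' < 0)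
    (hne : ∀ t ∈ Ioc a b, f t ≠ 0) : f b < 0 := by
  have h1 : ∀ᶠ t in 𝓝[>] a, slope f a t < 0 :=
    (hasDerivAt_iff_tendsto_slope.mp hd).mono_left
      (nhdsWithin_mono _ fun t ht => ne_of_gt ht) (Iio_mem_nhds hf')
  obtain ⟨t, hslope, hta, htb⟩ := (h1.and (Ioo_mem_nhdsGT hab)).exists
  rw [slope_def_field, ha, sub_zero, div_neg_iff] at hslope
  have hft : f t < 0 := by
    rcases hslope with h | h
    · linarith [h.2]
    · exact h.1
  by_contra hcon
  obtain ⟨s, hs, hs0⟩ := intermediate_value_Icc htb.le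
    (hcont.mono (Icc_subset_Icc_left hta.le)) ⟨hft.le, not_lt.mp hcon⟩
  exact hne s ⟨hta.trans_le hs.1, hs.2⟩ hs0

theorem IsTube.eq_of_height_eq_zero (hΩ : IsTube I z Ω) {x : Minkowski d} (hx : x ∈ Ω)
    {τ τ' : ℝ} (hτ : τ ∈ I) (hτ' : τ' ∈ I) (h : height z x τ = 0) (h' : height z x τ' = 0) :
    τ = τ' := by
  by_contra hne
  have h0 := hΩ.disjoint τ hτ τ' hτ' hne
  exact (h0 ▸ ⟨⟨hx, h⟩, h'⟩ : x ∈ (∅ : Set (Minkowski d)))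

theorem height_add_smul (x e : Minkowski d) (s τ : ℝ) :
    height z (x + s • e) τ = height z x τ + s * g d (deriv z τ) e := by
  rw [height, height, add_sub_right_comm, map_add, map_smul, smul_eq_mul]

theorem heightDeriv_add_smul (x e : Minkowski d) (s τ : ℝ) :
    heightDeriv c z (x + s • e) τ = heightDeriv c z x τ + s * g d (deriv (deriv z) τ) e := by
  rw [heightDeriv, heightDeriv, add_sub_right_comm, map_add, map_smul, smul_eq_mul]
  ring

/-- No point of a tube lies on the envelope of the hyperplanes: otherwise the hyperplanes through
nearby points would turn over there. -/
theorem IsTube.heightDeriv_ne_zero (hΩ : IsTube I z Ω) (hz : IsWorldline c I z) (hc : 0 < c)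
    {x : Minkowski d} (hx : x ∈ Ω) {τ : ℝ} (hτ : τ ∈ I) (h : height z x τ = 0) :
    heightDeriv c z x τ ≠ 0 := by
  intro h0
  -- Since `ż ⊥ z̈`, the points `x + s • e` stay on `H_τ`, while their height has derivative `s * g
  -- (e, e)` at `τ`, of sign opposite to `s`. Near `x` no other hyperplane passes through them, so
  -- the height at a fixed `τ₁ > τ` keeps that sign. Letting `s → 0` from both sides puts `x` on
  -- `H_τ₁` too.
  set e := deriv (deriv z) τ with he
  have hc2 := pow_pos hc 2
  have he0 : e ≠ 0 := by
    intro he0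
    rw [heightDeriv, ← he, he0, map_zero, LinearMap.zero_apply] at h0
    linarith
  have hge := hz.g_deriv_deriv_deriv hτ
  have hneg : g d e e < 0 := g_self_neg (by rw [hz.eigentime τ hτ]; exact hc2) hge he0
  obtain ⟨τ₁, hI₁, hlt⟩ : ∃ τ₁, Icc τ τ₁ ⊆ I ∧ τ < τ₁ := by
    obtain ⟨η, hη, hηI⟩ := Metric.nhds_basis_closedBall.mem_iff.mp (hz.isOpen.mem_nhds hτ)
    rw [Real.closedBall_eq_Icc] at hηI
    exact ⟨τ + η, (Icc_subset_Icc_left (by linarith)).trans hηI, by linarith⟩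
  have hI : τ₁ ∈ I := hI₁ (right_mem_Icc.mpr hlt.le)
  have hzero : ∀ s : ℝ, height z (x + s • e) τ = 0 := fun s => by
    rw [height_add_smul, h, hge, mul_zero, add_zero]
  have hev : ∀ᶠ s : ℝ in 𝓝 0, x + s • e ∈ Ω := by
    have hcont : ContinuousAt (fun s : ℝ => x + s • e) 0 := by fun_prop
    exact hcont.eventually_mem (hΩ.isOpen.mem_nhds (by simpa using hx))
  have hne : ∀ s : ℝ, x + s • e ∈ Ω → ∀ t ∈ Ioc τ τ₁, height z (x + s • e) t ≠ 0 :=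
    fun s hs t ht ht0 => ht.1.ne
      (hΩ.eq_of_height_eq_zero hs hτ (hI₁ (Ioc_subset_Icc_self ht)) (hzero s) ht0)
  have hder : ∀ s : ℝ, HasDerivAt (height z (x + s • e)) (s * g d e e) τ := fun s => by
    refine (hz.hasDerivAt_height _ hτ).congr_deriv ?_
    rw [heightDeriv_add_smul, h0, zero_add]
  have hlim : Tendsto (fun s : ℝ => height z (x + s • e) τ₁) (𝓝 0) (𝓝 (height z x τ₁)) := by
    have hcont : Continuous fun s : ℝ => height z x τ₁ + s * g d (deriv z τ₁) e := by fun_prop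
    simp only [height_add_smul]
    simpa using hcont.tendsto 0
  have hle : height z x τ₁ ≤ 0 := by
    refine le_of_tendsto (hlim.mono_left (nhdsWithin_le_nhds (s := Ioi 0))) ?_
    filter_upwards [hev.filter_mono nhdsWithin_le_nhds, self_mem_nhdsWithin] with s hs hs0
    exact (neg_of_hasDerivAt_neg hlt ((hz.continuousOn_height _).mono hI₁) (hzero s) (hder s)
      (mul_neg_of_pos_of_neg hs0 hneg) (hne s hs)).le
  have hge' : 0 ≤ height z x τ₁ := by
    refine ge_of_tendsto (hlim.mono_left (nhdsWithin_le_nhds (s := Iio 0))) ?_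
    filter_upwards [hev.filter_mono nhdsWithin_le_nhds, self_mem_nhdsWithin] with s hs hs0
    have := neg_of_hasDerivAt_neg hlt ((hz.continuousOn_height _).mono hI₁).neg
      (by simp [hzero s]) (hder s).neg (neg_neg_of_pos (mul_pos_of_neg_of_neg hs0 hneg))
      (fun t ht => neg_ne_zero.mpr (hne s hs t ht))
    simp only [Pi.neg_apply] at this
    linarith
  exact hlt.ne (hΩ.eq_of_height_eq_zero hx hτ hI h (le_antisymm hle hge'))

/-- No continuity of `T` is needed: near `x` the implicit function also picks a zero of the height
in `I`, and in a tube this zero is unique. -/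
theorem contDiffAt_of_height_eq_zero (hΩ : IsTube I z Ω) (hz : IsWorldline c I z) (hc : 0 < c)
    {T : Minkowski d → ℝ} (hT : ∀ x ∈ Ω, T x ∈ I ∧ height z x (T x) = 0) {x : Minkowski d}
    (hx : x ∈ Ω) : ContDiffAt ℝ 1 T x := by
  obtain ⟨hτ, h0⟩ := hT x hx
  have hf := hz.contDiffAt_height x hτ
  set f : Minkowski d × ℝ → ℝ := fun p => height z p.1 p.2 with hf_def
  have hinr : fderiv ℝ f (x, T x) ∘L .inr ℝ (Minkowski d) ℝ =
      (ContinuousLinearEquiv.unitsEquivAut ℝ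
        (Units.mk0 _ (hΩ.heightDeriv_ne_zero hz hc hx hτ h0)) : ℝ →L[ℝ] ℝ) := by
    have h1 : HasDerivAt (fun s => f (x, s)) (fderiv ℝ f (x, T x) (0, 1)) (T x) :=
      (hf.differentiableAt one_ne_zero).hasFDerivAt.comp_hasDerivAt (T x)
        ((hasDerivAt_const (T x) x).prodMk (hasDerivAt_id (T x)))
    ext
    simpa using h1.unique (hz.hasDerivAt_height x hτ)
  have hinv : (fderiv ℝ f (x, T x) ∘L .inr ℝ (Minkowski d) ℝ).IsInvertible := by
    rw [hinr]
    exact ContinuousLinearMap.isInvertible_equiv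
  have hS := hf.contDiffAt_implicitFunction one_ne_zero hinv
  refine hS.congr_of_eventuallyEq ?_
  have hSx : hf.implicitFunction one_ne_zero hinv x = T x :=
    hf.implicitFunction_apply_self one_ne_zero hinv
  filter_upwards [hf.eventually_apply_implicitFunction one_ne_zero hinv,
    hΩ.isOpen.eventually_mem hx,
    hS.continuousAt.eventually_mem (hz.isOpen.mem_nhds (by rw [hSx]; exact hτ))]
    with y hy hyΩ hyI
  exact hΩ.eq_of_height_eq_zero hyΩ (hT y hyΩ).1 hyI (hT y hyΩ).2 (hy.trans h0)

theorem IsTube.isIrrotationalRigidMotion_deriv_comp (hΩ : IsTube I z Ω)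
    (hz : IsWorldline c I z) (hc : 0 < c) {T : Minkowski d → ℝ}
    (hT : ∀ x ∈ Ω, T x ∈ I ∧ height z x (T x) = 0) :
    IsIrrotationalRigidMotion c Ω fun x => deriv z (T x) := by
  have hTd : ∀ x ∈ Ω, ContDiffAt ℝ 1 T x := fun x hx =>
    contDiffAt_of_height_eq_zero hΩ hz hc hT hx
  have hu : IsMotion c Ω fun x => deriv z (T x) :=
    ⟨hΩ.isOpen, fun x hx => (ContDiffAt.comp (g := deriv z) x
      (hz.contDiffAt_deriv (hT x hx).1) (hTd x hx)).contDiffWithinAt,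
      fun x hx => hz.eigentime _ (hT x hx).1⟩
  refine (hu.isIrrotationalRigidMotion_iff hc.ne').mpr fun x hx X => ?_
  obtain ⟨hτ, h0⟩ := hT x hx
  have hdT := ((hTd x hx).differentiableAt one_ne_zero).hasFDerivAt
  have hdu : ∀ Y, fderiv ℝ (fun x => deriv z (T x)) x Y =
      fderiv ℝ T x Y • deriv (deriv z) (T x) := fun Y => by
    have h : HasFDerivAt (fun x => deriv z (T x)) _ x :=
      (hz.hasDerivAt_deriv hτ).hasFDerivAt.comp x hdT
    rw [h.fderiv]
    simp
  -- This is the derivative of the identity `height z y (T y) = 0` at `y = x`.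
  have hker : ∀ Y, heightDeriv c z x (T x) * fderiv ℝ T x Y + g d (deriv z (T x)) Y = 0 := by
    intro Y
    have hf := ((hz.contDiffAt_height x hτ).differentiableAt one_ne_zero).hasFDerivAt
    have h1 := hf.comp x ((hasFDerivAt_id x).prodMk hdT)
    have h2 : (fun y => height z y (T y)) =ᶠ[𝓝 x] fun _ => 0 :=
      eventually_of_mem (hΩ.isOpen.mem_nhds hx) fun y hy => (hT y hy).2
    have h3 := congrArg (fun A => A Y)
      (h1.unique ((hasFDerivAt_const (0 : ℝ) x).congr_of_eventuallyEq h2))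
    have h4 : HasDerivAt (fun s => height z x s) _ (T x) :=
      hf.comp_hasDerivAt (T x) ((hasDerivAt_const (T x) x).prodMk (hasDerivAt_id (T x)))
    have h5 : HasFDerivAt (fun y => height z y (T x)) _ x :=
      HasFDerivAt.comp (f := fun y => (y, T x)) x hf ((hasFDerivAt_id x).prodMk (hasFDerivAt_const (T x) x))
    have h6 : HasFDerivAt (fun y => height z y (T x)) (gL d (deriv z (T x))) x :=
      ((gL d (deriv z (T x))).hasFDerivAt).comp x ((hasFDerivAt_id x).sub_const _)
    have h7 := congrArg (fun A => A Y) (h5.unique h6)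
    have h8 := h4.unique (hz.hasDerivAt_height x hτ)
    simp only [ContinuousLinearMap.comp_apply, ContinuousLinearMap.prod_apply,
      zero_apply, ContinuousLinearMap.id_apply] at h3 h7
    rw [gL_apply] at h7
    have h9 : ((Y, fderiv ℝ T x Y) : Minkowski d × ℝ) =
        (Y, 0) + fderiv ℝ T x Y • ((0 : Minkowski d), (1 : ℝ)) := by simp
    rw [h9, map_add, map_smul, h7, h8, smul_eq_mul] at h3
    linarith
  have hne := hΩ.heightDeriv_ne_zero hz hc hx hτ h0
  have hX := hker X
  -- Comparing `X` with `ż` eliminates the nonzero factor `heightDeriv` and gives `dT X = c⁻² g (ż,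
  -- X) dT ż`.
  have hu' := hker (deriv z (T x))
  rw [hz.eigentime _ hτ] at hu'
  rw [hdu, hdu, smul_smul]
  congr 1
  refine mul_left_cancel₀ hne ?_
  have hinv : (c ^ 2)⁻¹ * c ^ 2 = 1 := inv_mul_cancel₀ (pow_ne_zero 2 hc.ne')
  linear_combination hX - ((c ^ 2)⁻¹ * g d (deriv z (T x)) X) * hu' +
    g d (deriv z (T x)) X * hinv

theorem IsIrrotationalRigidMotion.congr (hu : IsIrrotationalRigidMotion c Ω u) (hc : c ≠ 0)
    (h : EqOn v u Ω) : IsIrrotationalRigidMotion c Ω v := by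
  have hv : IsMotion c Ω v := ⟨hu.isMotion.isOpen, hu.isMotion.contDiffOn.congr h,
    fun x hx => by rw [h hx]; exact hu.isMotion.normalized x hx⟩
  refine (hv.isIrrotationalRigidMotion_iff hc).mpr fun x hx X => ?_
  have he : v =ᶠ[𝓝 x] u := eventually_of_mem (hu.isMotion.isOpen.mem_nhds hx) h
  rw [he.fderiv_eq, h hx]
  exact (hu.isMotion.isIrrotationalRigidMotion_iff hc).mp hu x hx X

theorem IsIrrotationalRigidMotion.neg (hu : IsIrrotationalRigidMotion c Ω u) (hc : c ≠ 0) :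
    IsIrrotationalRigidMotion c Ω (-u) := by
  have hv : IsMotion c Ω (-u) := ⟨hu.isMotion.isOpen, hu.isMotion.contDiffOn.neg,
    fun x hx => by simpa using hu.isMotion.normalized x hx⟩
  refine (hv.isIrrotationalRigidMotion_iff hc).mpr fun x hx X => ?_
  rw [fderiv_neg]
  have := (hu.isMotion.isIrrotationalRigidMotion_iff hc).mp hu x hx X
  simp only [neg_apply, Pi.neg_apply, map_neg, LinearMap.neg_apply, neg_neg,
    mul_neg, neg_smul]
  rw [this]

/-- On a tube, the unit normal field exists and is unique up to sign. -/
theorem IsTube.exists_isNormalField (hΩ : IsTube I z Ω) (hz : IsWorldline c I z) (hc : 0 < c) :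
    ∃ u, IsIrrotationalRigidMotion c Ω u ∧ IsNormalField c I z Ω u ∧
      (∀ τ ∈ I, u (z τ) = deriv z τ) ∧
      ∀ v, IsNormalField c I z Ω v → EqOn v u Ω ∨ EqOn v (-u) Ω := by
  choose! T hT using hΩ.covered
  have hT' : ∀ x ∈ Ω, T x ∈ I ∧ height z x (T x) = 0 := hT
  have hTeq : ∀ τ ∈ I, ∀ x ∈ Ω, x ∈ orthHyperplane z τ → T x = τ := fun τ hτ x hx hxτ =>
    hΩ.eq_of_height_eq_zero hx (hT x hx).1 hτ (hT x hx).2 hxτ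
  have hu := hΩ.isIrrotationalRigidMotion_deriv_comp hz hc hT'
  have hc2 := pow_pos hc 2
  refine ⟨_, hu, ⟨hu.isMotion.contDiffOn.continuousOn, hu.isMotion.normalized, ?_⟩, ?_, ?_⟩
  · rintro τ hτ x ⟨hx, hxτ⟩ w hw
    simpa only [hTeq τ hτ x hx hxτ] using hw
  · intro τ hτ
    simp only [hTeq τ hτ (z τ) (hΩ.mapsTo hτ) (mem_orthHyperplane_self z τ)]
  · intro v hv
    set u := fun x => deriv z (T x)
    set k : Minkowski d → ℝ := fun x => (c ^ 2)⁻¹ * g d (u x) (v x) with hk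
    have hkc : ContinuousOn k Ω := continuousOn_const.mul
      (hu.isMotion.contDiffOn.continuousOn.minkowski_g hv.continuousOn)
    have huv : ∀ x ∈ Ω, v x = k x • u x := by
      intro x hx
      have hn : g d (u x) (u x) = c ^ 2 := hu.isMotion.normalized x hx
      have h1 : g d (u x) (v x - k x • u x) = 0 := by
        rw [map_sub, map_smul, hn, smul_eq_mul, hk]
        field_simp
        ring
      have h2 : g d (v x) (v x - k x • u x) = 0 :=
        hv.perpendicular (T x) (hT x hx).1 x ⟨hx, (hT x hx).2⟩ _ h1
      -- The difference `v x - k x • u x` is orthogonal to both `u x` and `v x`, hence null; but a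
      -- nonzero vector orthogonal to `u x` is spacelike.
      by_contra hne
      have h3 := g_self_neg (by rw [hn]; exact hc2) h1 (sub_ne_zero.mpr hne)
      simp [h1, h2] at h3
    have hsq : EqOn (k ^ 2) 1 Ω := by
      intro x hx
      have h1 := hv.normalized x hx
      have hn : g d (u x) (u x) = c ^ 2 := hu.isMotion.normalized x hx
      rw [huv x hx, map_smul, map_smul, LinearMap.smul_apply, hn] at h1
      simp only [smul_eq_mul] at h1
      simp only [Pi.pow_apply, Pi.one_apply]
      exact mul_right_cancel₀ hc2.ne' (by linarith)
    rcases hΩ.isConnected.isPreconnected.eq_one_or_eq_neg_one_of_sq_eq hkc hsq with h | h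
    · left
      intro x hx
      rw [huv x hx, h hx, Pi.one_apply, one_smul]
    · right
      intro x hx
      rw [huv x hx, h hx, Pi.neg_apply, Pi.one_apply, Pi.neg_apply, neg_smul, one_smul]


end Minkowski

namespace Minkowski

variable {d : ℕ} {c : ℝ} {I : Set ℝ} {z : ℝ → Minkowski d} {Ω U : Set (Minkowski d)}
  {u : Minkowski d → Minkowski d}

/-! ### Flow lines of irrotational rigid motions -/

theorem IsMotion.exists_isFlowLine (hu : IsMotion c Ω u) {p : Minkowski d} (hp : p ∈ Ω) :
    ∃ (I : Set ℝ) (z : ℝ → Minkowski d), IsFlowLine Ω u I z ∧ p ∈ z '' I := by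
  obtain ⟨z, hz0, η, hη, hz⟩ := (hu.contDiffOn.contDiffAt
    (hu.isOpen.mem_nhds hp)).exists_forall_mem_closedBall_exists_eq_forall_mem_Ioo_hasDerivAt₀ 0
  have h0 : (0 : ℝ) ∈ Ioo (0 - η) (0 + η) := ⟨by linarith, by linarith⟩
  have hev : ∀ᶠ t in 𝓝 (0 : ℝ), z t ∈ Ω ∧ t ∈ Ioo (0 - η) (0 + η) :=
    ((hz 0 h0).continuousAt.eventually_mem (hu.isOpen.mem_nhds (by rwa [hz0]))).and
      (isOpen_Ioo.eventually_mem h0)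
  obtain ⟨δ, hδ, hball⟩ := Metric.nhds_basis_ball.eventually_iff.mp hev
  exact ⟨Metric.ball 0 δ, z, ⟨Metric.isOpen_ball, ⟨0, Metric.mem_ball_self hδ⟩,
    (convex_ball 0 δ).ordConnected, fun t ht => (hball ht).1,
    fun t ht => (hz t (hball ht).2).hasDerivWithinAt⟩, 0, Metric.mem_ball_self hδ, hz0⟩

theorem IsFlowLine.hasDerivAt (hz : IsFlowLine Ω u I z) {τ : ℝ} (hτ : τ ∈ I) :
    HasDerivAt z (u (z τ)) τ :=
  (hz.isIntegralCurve τ hτ).hasDerivAt (hz.isOpen.mem_nhds hτ)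

/-- Bootstrapping with `ż = u ∘ z`: the curve is `C^1`, so `ż` is `C^1`. -/
theorem IsFlowLine.isWorldline (hz : IsFlowLine Ω u I z) (hu : IsMotion c Ω u) :
    IsWorldline c I z := by
  have hd : EqOn (deriv z) (u ∘ z) I := fun τ hτ => (hz.hasDerivAt hτ).deriv
  have hdiff : DifferentiableOn ℝ z I := fun τ hτ =>
    (hz.hasDerivAt hτ).differentiableAt.differentiableWithinAt
  have hcont : ContinuousOn (deriv z) I :=
    (hu.contDiffOn.continuousOn.comp hdiff.continuousOn hz.mapsTo).congr hd
  have h1 : ContDiffOn ℝ 1 z I := by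
    have := (contDiffOn_succ_iff_deriv_of_isOpen (n := 0) hz.isOpen).mpr
      ⟨hdiff, by simp, contDiffOn_zero.mpr hcont⟩
    simpa using this
  have h2 : ContDiffOn ℝ 1 (deriv z) I := (hu.contDiffOn.comp h1 hz.mapsTo).congr hd
  refine ⟨hz.isOpen, hz.nonempty, hz.ordConnected, ?_, fun τ hτ => ?_⟩
  · have := (contDiffOn_succ_iff_deriv_of_isOpen (n := 1) hz.isOpen).mpr ⟨hdiff, by simp, h2⟩
    simpa [one_add_one_eq_two] using this
  · rw [hd hτ]
    exact hu.normalized _ (hz.mapsTo hτ)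

/-- An irrotational rigid motion is constant along the segments that start perpendicularly
to it. -/
theorem IsIrrotationalRigidMotion.eq_of_segment_subset (hu : IsIrrotationalRigidMotion c Ω u)
    (hc : c ≠ 0) {p q : Minkowski d} (hseg : segment ℝ p q ⊆ Ω) (hpq : g d (u p) (q - p) = 0) :
    u q = u p := by
  set w := q - p with hw
  set γ : ℝ → Minkowski d := fun t => p + t • w with hγ
  have hγΩ : ∀ t ∈ Icc (0 : ℝ) 1, γ t ∈ Ω := fun t ht => hseg (by
    rw [segment_eq_image']
    exact mem_image_of_mem _ ht)
  have hγd : ∀ t, HasDerivAt γ w t := fun t => by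
    exact (((hasDerivAt_id t).smul_const w).const_add p).congr_deriv (one_smul ℝ w)
  have hγc : ContinuousOn γ (Icc 0 1) := fun t _ => (hγd t).continuousAt.continuousWithinAt
  have key := (hu.isMotion.isIrrotationalRigidMotion_iff hc).mp hu
  have hφd : ∀ t ∈ Icc (0 : ℝ) 1, HasDerivAt (fun t => u (γ t))
      (((c ^ 2)⁻¹ * g d (u (γ t)) w) • fderiv ℝ u (γ t) (u (γ t))) t := fun t ht => by
    rw [← key _ (hγΩ t ht) w]
    exact (hu.isMotion.differentiableAt (hγΩ t ht)).hasFDerivAt.comp_hasDerivAt t (hγd t)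
  have huc : ContinuousOn (fun t => u (γ t)) (Icc 0 1) := fun t ht =>
    (hφd t ht).continuousAt.continuousWithinAt
  have hfd : ∀ t ∈ Icc (0 : ℝ) 1, HasDerivAt (fun t => g d (u (γ t)) w)
      (((c ^ 2)⁻¹ * g d (fderiv ℝ u (γ t) (u (γ t))) w) * g d (u (γ t)) w) t := fun t ht => by
    refine ((hφd t ht).minkowski_g (hasDerivAt_const t w)).congr_deriv ?_
    rw [map_zero, map_smul, LinearMap.smul_apply, smul_eq_mul]
    ring
  have hac : ContinuousOn (fun t => (c ^ 2)⁻¹ * g d (fderiv ℝ u (γ t) (u (γ t))) w)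
      (Icc 0 1) := by
    have h1 : ContinuousOn (fderiv ℝ u) Ω :=
      hu.isMotion.contDiffOn.continuousOn_fderiv_of_isOpen hu.isMotion.isOpen le_rfl
    exact continuousOn_const.mul
      (((h1.comp hγc hγΩ).clm_apply huc).minkowski_g continuousOn_const)
  obtain ⟨K, hK⟩ := isCompact_Icc.exists_bound_of_continuousOn hac
  have hγ0 : γ 0 = p := by simp [hγ]
  -- By `hfd` this function solves `f' = a f` with `f 0 = 0`, and `a` is bounded by `K`; Grönwall's
  -- inequality gives `f = 0`.
  have hf0 : ∀ t ∈ Icc (0 : ℝ) 1, g d (u (γ t)) w = 0 := by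
    refine eq_zero_of_abs_deriv_le_mul_abs_self_of_eq_zero_right (K := K)
      (fun t ht => (hfd t ht).continuousAt.continuousWithinAt)
      (fun t ht => (hfd t (Ico_subset_Icc_self ht)).hasDerivWithinAt)
      (by rw [hγ0, hpq]) fun t ht => ?_
    rw [norm_mul]
    exact mul_le_mul_of_nonneg_right (hK t (Ico_subset_Icc_self ht)) (norm_nonneg _)
  have hconst := constant_of_has_deriv_right_zero huc (fun t ht => by
    have h := hφd t (Ico_subset_Icc_self ht)
    rw [hf0 t (Ico_subset_Icc_self ht), mul_zero, zero_smul] at h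
    exact h.hasDerivWithinAt) 1 ⟨zero_le_one, le_rfl⟩
  simpa [hγ, hw] using hconst

/-- Constancy along slices gives `u = ż τ` on each. If `x` lay on `H_τ` and `H_τ'` with `τ < τ'`,
then `ż τ = ż τ'` would be orthogonal to `z τ' - z τ`, against `IsWorldline.g_sub_pos`. -/
theorem IsFlowLine.isTube_and_isNormalField (hz : IsFlowLine Ω u I z)
    (hu : IsIrrotationalRigidMotion c Ω u) (hc : 0 < c) (hUΩ : U ⊆ Ω) (hU : IsOpen U)
    (hmaps : MapsTo z I U) (hcov : ∀ x ∈ U, ∃ τ ∈ I, x ∈ orthHyperplane z τ)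
    (hstar : HasStarSlices I z U) : IsTube I z U ∧ IsNormalField c I z U u := by
  have hw := hz.isWorldline hu.isMotion
  have hslice : ∀ τ ∈ I, ∀ x ∈ U ∩ orthHyperplane z τ, u x = deriv z τ := by
    intro τ hτ x hx
    rw [(hz.hasDerivAt hτ).deriv]
    refine hu.eq_of_segment_subset hc.ne'
      (((hstar τ hτ).segment_subset hx).trans (inter_subset_left.trans hUΩ)) ?_
    rw [← (hz.hasDerivAt hτ).deriv]
    exact hx.2
  obtain ⟨ε, hε⟩ := hw.exists_timeCone hc
  have hlt : ∀ x ∈ U, ∀ τ ∈ I, ∀ τ' ∈ I, x ∈ orthHyperplane z τ → x ∈ orthHyperplane z τ' →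
      ¬ τ < τ' := by
    intro x hx τ hτ τ' hτ' h h' hlt
    have h1 := hw.g_sub_pos hε (hε τ hτ) hτ hτ' hlt
    have heq : deriv z τ' = deriv z τ :=
      (hslice τ' hτ' x ⟨hx, h'⟩).symm.trans (hslice τ hτ x ⟨hx, h⟩)
    rw [mem_orthHyperplane_iff, height, map_sub] at h h'
    rw [heq] at h'
    rw [map_sub] at h1
    linarith
  refine ⟨⟨hU, hstar.isConnected hw.continuousOn hw.ordConnected hw.nonempty hmaps hcov, hmaps,
    hcov, fun τ hτ τ' hτ' hne => ?_⟩, hu.isMotion.contDiffOn.continuousOn.mono hUΩ,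
    fun x hx => hu.isMotion.normalized x (hUΩ hx), fun τ hτ x hx w hw => ?_⟩
  · refine eq_empty_of_forall_notMem ?_
    rintro x ⟨⟨hx, h⟩, h'⟩
    rcases lt_or_gt_of_ne hne with hlt' | hlt'
    · exact hlt x hx τ hτ τ' hτ' h h' hlt'
    · exact hlt x hx τ' hτ' τ hτ h' h hlt'
  · rwa [hslice τ hτ x hx]

end Minkowski

/-! ### Assembly of both directions -/

theorem mainTheorem2 (d : ℕ) (c : ℝ) (hc : 0 < c) :
    -- every worldline has a tube, and the construction gives an irrotational rigid motion
    (∀ (I : Set ℝ) (z : ℝ → Minkowski d), Minkowski.IsWorldline c I z →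
      (∃ Ω : Set (Minkowski d), Minkowski.IsTube I z Ω ∧ Minkowski.HasStarSlices I z Ω) ∧
      (∀ Ω : Set (Minkowski d), Minkowski.IsTube I z Ω →
        (∃ u : Minkowski d → Minkowski d, Minkowski.IsNormalField c I z Ω u ∧
          (∀ τ ∈ I, u (z τ) = deriv z τ) ∧
          (∀ v : Minkowski d → Minkowski d, Minkowski.IsNormalField c I z Ω v →
            Set.EqOn v u Ω ∨ Set.EqOn v (-u) Ω)) ∧
        (∀ u : Minkowski d → Minkowski d, Minkowski.IsNormalField c I z Ω u →
          Minkowski.IsIrrotationalRigidMotion c Ω u))) ∧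
    -- every irrotational rigid motion arises in this way, about each of its flow lines
    (∀ (Ω : Set (Minkowski d)) (u : Minkowski d → Minkowski d),
      Minkowski.IsIrrotationalRigidMotion c Ω u →
      (∀ p ∈ Ω, ∃ (I : Set ℝ) (z : ℝ → Minkowski d), Minkowski.IsFlowLine Ω u I z ∧ p ∈ z '' I) ∧
      (∀ (I : Set ℝ) (z : ℝ → Minkowski d), Minkowski.IsFlowLine Ω u I z →
        Minkowski.IsWorldline c I z ∧
        (∃ U ⊆ Ω, Minkowski.IsTube I z U ∧ Minkowski.HasStarSlices I z U ∧
          Minkowski.IsNormalField c I z U u) ∧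
        (∀ U ⊆ Ω, IsOpen U → Set.MapsTo z I U →
          (∀ x ∈ U, ∃ τ ∈ I, x ∈ Minkowski.orthHyperplane z τ) →
          Minkowski.HasStarSlices I z U →
          Minkowski.IsTube I z U ∧ Minkowski.IsNormalField c I z U u))) := by
  refine ⟨fun I z hz => ⟨?_, fun Ω hΩ => ?_⟩, fun Ω u hu => ⟨fun p hp =>
    hu.isMotion.exists_isFlowLine hp, fun I z hz => ⟨hz.isWorldline hu.isMotion, ?_, ?_⟩⟩⟩
  · obtain ⟨U, -, hU⟩ := hz.exists_isTube hc isOpen_univ (Set.mapsTo_univ z I)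
    exact ⟨U, hU⟩
  · obtain ⟨u, hu, hn, huz, huniq⟩ := hΩ.exists_isNormalField hz hc
    refine ⟨⟨u, hn, huz, huniq⟩, fun v hv => ?_⟩
    rcases huniq v hv with h | h
    · exact hu.congr hc.ne' h
    · exact (hu.neg hc.ne').congr hc.ne' h
  · obtain ⟨U, hUΩ, hU, hstar⟩ :=
      (hz.isWorldline hu.isMotion).exists_isTube hc hu.isMotion.isOpen hz.mapsTo
    exact ⟨U, hUΩ, hU, hstar, (hz.isTube_and_isNormalField hu hc hUΩ hU.isOpen hU.mapsTo
      hU.covered hstar).2⟩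
  · exact fun U hUΩ hU hmaps hcov hstar =>
      hz.isTube_and_isNormalField hu hc hUΩ hU hmaps hcov hstar
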